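/- Let $n$ be a non-negative integer, $K$ a field, and $K[[x_1,\dots,x_n]]$ the algebra of commutative formal power series with the $(x_1,\dots,x_n)$-adic topology $\tau$, that is, the topology of the metric $\delta(f,g)=2^{-\mathrm{val}(f-g)}$, where $\mathrm{val}(h)$ is the lowest degree of a monomial with non-zero coefficient in $h$ (and $\delta(f,f)=0$). Let $<$ be a monomial order (a well-order on the monomials such that $m_1<m_2$ implies $m_1m_3<m_2m_3$) that is compatible with the degree: $\deg m_1<\deg m_2$ implies $m_1<m_2$. For $f\neq 0$, let $\mathrm{lm}(f)$ be the smallest monomial for $<$ in the support $\mathrm{supp}(f)$, let $\mathrm{lc}(f)$ be its coefficient in $f$, and let $\mathrm{rem}(f)=\mathrm{lc}(f)\,\mathrm{lm}(f)-f$. Let $G\subseteq K[[x_1,\dots,x_n]]$ be a set, finite or infinite, and let $I(G)$ be the ideal it generates. $G$ is a standard basis of $I(G)$ if for every non-zero $f\in I(G)$ there is a non-zero $g\in G$ such that $\mathrm{lm}(g)$ divides $\mathrm{lm}(f)$. The rewriting relation $\to$ induced by $G$ and $<$ is $$\lambda\, m\,\mathrm{lm}(s)+S\;\to\;\frac{\lambda}{\mathrm{lc}(s)}\,m\,\mathrm{rem}(s)+S,$$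 for $\lambda\in K\setminus\{0\}$, $m$ a monomial, $s\in G$ non-zero, and $S\in K[[x_1,\dots,x_n]]$ with $m\,\mathrm{lm}(s)\notin\mathrm{supp}(S)$. Write $\to^{*}$ for its reflexive transitive closure, and write $a\rightsquigarrow b$ if $(a,b)$ lies in the closure of $\to^{*}$ for the product of the discrete topology and $\tau$, that is, if every neighbourhood of $b$ for $\tau$ contains some $b'$ with $a\to^{*}b'$. The relation $\to$ is infinitary confluent if for all $a,b,c$ with $a\rightsquigarrow b$ and $a\rightsquigarrow c$ there is $d$ with $b\rightsquigarrow d$ and $c\rightsquigarrow d$. Then $G$ is a standard basis of $I(G)$ if and only if $\to$ is infinitary confluent. -/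

import Mathlib

/-! ### Topological rewriting systems

A topological rewriting system is a type `A` with a topology `τ` and a relation `R` on `A`. -/

namespace TopRewriting

/-- `a` rewrites to `b` in possibly infinitely many steps: `(a, b)` lies in the closure of the
reflexive transitive closure of `R`, for the product of the discrete topology and `τ`. -/
def TopRew {A : Type*} (τ : TopologicalSpace A) (R : A → A → Prop) (a b : A) : Prop :=
  (a, b) ∈ @closure (A × A) (@instTopologicalSpaceProd A A ⊥ τ)
    {p : A × A | Relation.ReflTransGen R p.1 p.2}

/-- Neighbourhood form of `TopRew`. -/
theorem topRew_iff {A : Type*} (τ : TopologicalSpace A) (R : A → A → Prop) (a b : A) :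
    TopRew τ R a b ↔ ∀ V ∈ @nhds A τ b, ∃ b' ∈ V, Relation.ReflTransGen R a b' := by
  unfold TopRew
  rw [@mem_closure_iff_nhds (A × A) (@instTopologicalSpaceProd A A ⊥ τ)]
  rw [@nhds_prod_eq A A ⊥ τ, @nhds_discrete A ⊥ (@DiscreteTopology.mk A ⊥ rfl)]
  constructor
  · intro h V hV
    obtain ⟨⟨x, y⟩, ⟨hx, hy⟩, hr⟩ := h ({a} ×ˢ V)
      (Filter.prod_mem_prod (Filter.mem_pure.2 rfl) hV)
    have hxa : x = a := hx
    subst hxa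
    exact ⟨y, hy, hr⟩
  · intro h t ht
    rw [Filter.mem_prod_iff] at ht
    obtain ⟨t₁, ht₁, t₂, ht₂, hsub⟩ := ht
    obtain ⟨b', hb', hr⟩ := h t₂ ht₂
    exact ⟨(a, b'), hsub ⟨Filter.mem_pure.1 ht₁, hb'⟩, hr⟩

/-- Infinitary confluence of `(A, τ, R)`. -/
def InfinitaryConfluent {A : Type*} (τ : TopologicalSpace A) (R : A → A → Prop) : Prop :=
  ∀ a b c : A, TopRew τ R a b → TopRew τ R a c → ∃ d : A, TopRew τ R b d ∧ TopRew τ R c d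

end TopRewriting

/-! ### Formal power series in finitely many commuting variables over a field

A monomial `x₁ ^ μ₁ ⋯ xₙ ^ μₙ` is represented by its exponent `μ : Fin n →₀ ℕ`, so that the
product of monomials is the sum of exponents and divisibility is the order `≤` on exponents. -/

noncomputable section

namespace FPS

/-- The metric `δ(f, g) = 2 ^ (-val (f - g))`, where `val h`, the lowest degree of a monomial of
the support of `h`, is `MvPowerSeries.order h`, and where `δ(f, f) = 0`. -/
def delta {n : ℕ} {K : Type*} [Field K] (f g : MvPowerSeries (Fin n) K) : ℝ :=
  open Classical in if f = g then 0 else (1 / 2 : ℝ) ^ (f - g).order.toNat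

theorem delta_comm {n : ℕ} {K : Type*} [Field K] (f g : MvPowerSeries (Fin n) K) :
    delta f g = delta g f := by
  unfold delta
  by_cases h : f = g
  · rw [if_pos h, if_pos h.symm]
  · rw [if_neg h, if_neg (Ne.symm h), ← neg_sub f g, MvPowerSeries.order_neg]

theorem delta_nonneg {n : ℕ} {K : Type*} [Field K] (f g : MvPowerSeries (Fin n) K) :
    0 ≤ delta f g := by
  unfold delta
  split_ifs
  · exact le_rfl
  · positivity

theorem delta_le_max {n : ℕ} {K : Type*} [Field K] (f g h : MvPowerSeries (Fin n) K) :
    delta f h ≤ max (delta f g) (delta g h) := by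
  by_cases hfg : f = g
  · subst hfg
    exact le_max_right _ _
  by_cases hgh : g = h
  · subst hgh
    exact le_max_left _ _
  by_cases hfh : f = h
  · subst hfh
    exact le_trans (by simp [delta]) (le_max_of_le_left (delta_nonneg f g))
  unfold delta
  rw [if_neg hfg, if_neg hgh, if_neg hfh]
  have key : min (f - g).order (g - h).order ≤ (f - h).order := by
    have := MvPowerSeries.min_order_le_add (f := f - g) (g := g - h)
    simpa using this
  have hne : (f - h).order ≠ ⊤ := by
    rw [Ne, MvPowerSeries.order_eq_top_iff]
    exact sub_ne_zero.2 hfh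
  rcases min_le_iff.1 key with h1 | h1
  · exact le_max_of_le_left
      (pow_le_pow_of_le_one (by norm_num) (by norm_num) (ENat.toNat_le_toNat h1 hne))
  · exact le_max_of_le_right
      (pow_le_pow_of_le_one (by norm_num) (by norm_num) (ENat.toNat_le_toNat h1 hne))

/-- The metric space structure on formal power series given by `delta`. -/
@[reducible] def metric (n : ℕ) (K : Type*) [Field K] : MetricSpace (MvPowerSeries (Fin n) K) where
  dist := delta
  dist_self f := by simp [delta]
  dist_comm := delta_comm
  dist_triangle f g h := (delta_le_max f g h).trans
    (max_le_add_of_nonneg (delta_nonneg f g) (delta_nonneg g h))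
  eq_of_dist_eq_zero := by
    intro f g h
    by_contra hne
    have h' : delta f g = 0 := h
    unfold delta at h'
    rw [if_neg hne] at h'
    exact absurd h' (by positivity)

/-- The `(x₁, …, xₙ)`-adic topology, induced by the metric `delta`. -/
@[reducible] def adicTopology (n : ℕ) (K : Type*) [Field K] :
    TopologicalSpace (MvPowerSeries (Fin n) K) :=
  (metric n K).toPseudoMetricSpace.toUniformSpace.toTopologicalSpace

/-- A monomial order `ord` is compatible with the degree if `deg a < deg b` implies `a < b`. -/
def CompatibleWithDegree {n : ℕ} (ord : MonomialOrder (Fin n)) : Prop :=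
  ∀ a b : Fin n →₀ ℕ, a.degree < b.degree → ord.toSyn a < ord.toSyn b

/-- The support of a formal power series. -/
def supp {n : ℕ} {K : Type*} [Field K] (f : MvPowerSeries (Fin n) K) : Set (Fin n →₀ ℕ) :=
  {d | MvPowerSeries.coeff d f ≠ 0}

theorem supp_nonempty {n : ℕ} {K : Type*} [Field K] {f : MvPowerSeries (Fin n) K} (hf : f ≠ 0) :
    (supp f).Nonempty :=
  (MvPowerSeries.ne_zero_iff_exists_coeff_ne_zero f).1 hf

/-- The leading monomial of a non-zero `f`: the greatest element of the support of `f` for the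
order opposite to `ord`, that is, the smallest one for `ord`. The value at `f = 0` is a default. -/
def lm {n : ℕ} {K : Type*} [Field K] (ord : MonomialOrder (Fin n))
    (f : MvPowerSeries (Fin n) K) : Fin n →₀ ℕ :=
  open Classical in
  if hf : f = 0 then 0 else Function.argminOn ord.toSyn (supp f) (supp_nonempty hf)

/-- The leading coefficient. -/
def lc {n : ℕ} {K : Type*} [Field K] (ord : MonomialOrder (Fin n))
    (f : MvPowerSeries (Fin n) K) : K :=
  MvPowerSeries.coeff (lm ord f) f

/-- The remainder `lc(f) lm(f) - f`. -/
def rem {n : ℕ} {K : Type*} [Field K] (ord : MonomialOrder (Fin n))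
    (f : MvPowerSeries (Fin n) K) : MvPowerSeries (Fin n) K :=
  MvPowerSeries.monomial (lm ord f) (lc ord f) - f

/-- `G` is a standard basis of the ideal `I`: it is contained in `I` and the leading monomial of
every non-zero element of `I` is divisible by the leading monomial of a (non-zero) element
of `G`. -/
def IsStandardBasis {n : ℕ} {K : Type*} [Field K] (ord : MonomialOrder (Fin n))
    (G : Set (MvPowerSeries (Fin n) K)) (I : Ideal (MvPowerSeries (Fin n) K)) : Prop :=
  (∀ g ∈ G, g ∈ I) ∧ ∀ f ∈ I, f ≠ 0 → ∃ g ∈ G, g ≠ 0 ∧ lm ord g ≤ lm ord f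

/-- The rewriting relation induced by `G`:
`c (m lm(s)) + S → (c / lc(s)) (m rem(s)) + S` for a non-zero scalar `c`, a monomial `m`,
a non-zero `s ∈ G` and a formal power series `S` whose support does not contain `m lm(s)`. -/
def Rew {n : ℕ} {K : Type*} [Field K] (ord : MonomialOrder (Fin n))
    (G : Set (MvPowerSeries (Fin n) K)) (f g : MvPowerSeries (Fin n) K) : Prop :=
  ∃ (c : K) (m : Fin n →₀ ℕ) (s S : MvPowerSeries (Fin n) K),
    c ≠ 0 ∧ s ∈ G ∧ s ≠ 0 ∧ m + lm ord s ∉ supp S ∧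
    f = MvPowerSeries.monomial (m + lm ord s) c + S ∧
    g = (c / lc ord s) • (MvPowerSeries.monomial m (1 : K) * rem ord s) + S

end FPS

end

/-! Compatibility with the degree makes a step at a monomial of degree at least `N` invisible below
degree `N`, where only finitely many monomials live. Cancelling smallest reducible terms therefore
converges: every series has a normal form (`exists_normalForm`).

If `G` is a standard basis and `b`, `c` come from the same `a`, let `d`, `e` be normal forms of
them. The difference `d - e` is a limit of elements of the ideal. Were it non-zero, its leading
monomial would be that of an element of the ideal, hence reducible, yet neither `d` nor `e` has a
reducible term (`IsStandardBasis.exists_common`).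

Conversely, a single generator is always a standard basis of its principal ideal, so `h + q * s` and
`h` have a common reduct for each `s` in `G`. Confluence and transitivity of infinitary rewriting
extend this from generators to the whole ideal. With `h = 0` and `q = 1`, an element `f` of the
ideal rewrites to `0`, as `0` only rewrites to itself. An irreducible leading term of `f` would
survive, so there is none. -/

namespace FPS

open TopRewriting Relation

variable {n : ℕ} {K : Type*} [Field K] {ord : MonomialOrder (Fin n)}
  {G : Set (MvPowerSeries (Fin n) K)}

/-! ### Agreement up to a degree -/

/-- `f` and `g` have the same coefficients in degrees less than `N`. -/
def AgreeBelow (N : ℕ) (f g : MvPowerSeries (Fin n) K) : Prop :=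
  ∀ μ : Fin n →₀ ℕ, μ.degree < N → MvPowerSeries.coeff μ f = MvPowerSeries.coeff μ g

theorem AgreeBelow.trans {N : ℕ} {f g h : MvPowerSeries (Fin n) K} (h₁ : AgreeBelow N f g)
    (h₂ : AgreeBelow N g h) : AgreeBelow N f h := fun μ hμ => (h₁ μ hμ).trans (h₂ μ hμ)

theorem agreeBelow_of_delta_lt {N : ℕ} {f g : MvPowerSeries (Fin n) K}
    (h : delta f g < (1 / 2) ^ N) : AgreeBelow N f g := by
  intro μ hμ
  by_cases hfg : f = g
  · rw [hfg]
  unfold delta at h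
  rw [if_neg hfg] at h
  have h1 : N < (f - g).order.toNat := (pow_lt_pow_iff_right_of_lt_one₀ (by norm_num)
    (by norm_num)).1 h
  have hne : (f - g).order ≠ ⊤ := by
    rw [Ne, MvPowerSeries.order_eq_top_iff]
    exact sub_ne_zero.2 hfg
  have h2 : ((μ.degree : ℕ) : ℕ∞) < (f - g).order := by
    rw [← ENat.natCast_toNat hne]
    exact_mod_cast hμ.trans h1
  have h3 := MvPowerSeries.coeff_of_lt_order h2
  rwa [map_sub, sub_eq_zero] at h3

/-- Agreement below `N + 1` gives order at least `N + 1`; the extra degree makes the inequality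
strict. -/
theorem AgreeBelow.delta_lt {N : ℕ} {f g : MvPowerSeries (Fin n) K}
    (h : AgreeBelow (N + 1) f g) : delta f g < (1 / 2) ^ N := by
  by_cases hfg : f = g
  · simp [delta, hfg]
  unfold delta
  rw [if_neg hfg]
  have hne : (f - g).order ≠ ⊤ := by
    rw [Ne, MvPowerSeries.order_eq_top_iff]
    exact sub_ne_zero.2 hfg
  have h1 : ((N + 1 : ℕ) : ℕ∞) ≤ (f - g).order := by
    refine MvPowerSeries.le_order fun μ hμ => ?_
    rw [map_sub, sub_eq_zero]
    exact h μ (by exact_mod_cast hμ)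
  rw [← ENat.natCast_toNat hne] at h1
  exact (pow_lt_pow_iff_right_of_lt_one₀ (by norm_num) (by norm_num)).2 (by exact_mod_cast h1)

theorem topRew_iff_agreeBelow (R : MvPowerSeries (Fin n) K → MvPowerSeries (Fin n) K → Prop)
    (a b : MvPowerSeries (Fin n) K) :
    TopRew (adicTopology n K) R a b ↔ ∀ N, ∃ b', AgreeBelow N b' b ∧ ReflTransGen R a b' := by
  rw [topRew_iff]
  let _ := metric n K
  constructor
  · intro h N
    obtain ⟨b', hb', hr⟩ := h _ (Metric.ball_mem_nhds b (show (0 : ℝ) < (1 / 2) ^ N by positivity))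
    exact ⟨b', agreeBelow_of_delta_lt hb', hr⟩
  · intro h V hV
    obtain ⟨ε, hε, hsub⟩ := Metric.mem_nhds_iff.1 hV
    obtain ⟨N, hN⟩ := exists_pow_lt_of_lt_one hε (show (1 / 2 : ℝ) < 1 by norm_num)
    obtain ⟨b', hb', hr⟩ := h (N + 1)
    exact ⟨b', hsub (lt_trans hb'.delta_lt hN), hr⟩

theorem topRew_of_reflTransGen {R : MvPowerSeries (Fin n) K → MvPowerSeries (Fin n) K → Prop}
    {a b : MvPowerSeries (Fin n) K} (h : ReflTransGen R a b) :
    TopRew (adicTopology n K) R a b :=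
  (topRew_iff_agreeBelow R a b).2 fun _ => ⟨b, fun _ _ => rfl, h⟩

/-! ### Leading monomials -/

theorem lc_ne_zero {f : MvPowerSeries (Fin n) K} (hf : f ≠ 0) : lc ord f ≠ 0 := by
  unfold lc lm
  rw [dif_neg hf]
  exact Function.argminOn_mem ord.toSyn (supp f) (supp_nonempty hf)

theorem lm_le {f : MvPowerSeries (Fin n) K} {μ : Fin n →₀ ℕ}
    (hμ : MvPowerSeries.coeff μ f ≠ 0) : ord.toSyn (lm ord f) ≤ ord.toSyn μ := by
  have hf : f ≠ 0 := by
    rintro rfl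
    simp at hμ
  unfold lm
  rw [dif_neg hf]
  exact Function.argminOn_le ord.toSyn (supp f) hμ

theorem coeff_eq_zero_of_lt_lm {f : MvPowerSeries (Fin n) K} {μ : Fin n →₀ ℕ}
    (hμ : ord.toSyn μ < ord.toSyn (lm ord f)) : MvPowerSeries.coeff μ f = 0 := by
  by_contra h
  exact (lm_le h).not_gt hμ

theorem lm_eq_of {f : MvPowerSeries (Fin n) K} {μ : Fin n →₀ ℕ}
    (hμ : MvPowerSeries.coeff μ f ≠ 0)
    (h : ∀ ν, ord.toSyn ν < ord.toSyn μ → MvPowerSeries.coeff ν f = 0) : lm ord f = μ := by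
  have hf : f ≠ 0 := by
    rintro rfl
    simp at hμ
  refine ord.toSyn.injective (le_antisymm (lm_le hμ) (le_of_not_gt fun hlt => ?_))
  exact lc_ne_zero hf (h _ hlt)

theorem coeff_add_lm_monomial_mul (m : Fin n →₀ ℕ) (s : MvPowerSeries (Fin n) K) :
    MvPowerSeries.coeff (m + lm ord s) (MvPowerSeries.monomial m (1 : K) * s) = lc ord s := by
  rw [MvPowerSeries.coeff_add_monomial_mul, one_mul, lc]

theorem coeff_mul_eq_zero_of_lt {q s : MvPowerSeries (Fin n) K} {m ν : Fin n →₀ ℕ}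
    (hq : ∀ μ, ord.toSyn μ < ord.toSyn m → MvPowerSeries.coeff μ q = 0)
    (hν : ord.toSyn ν < ord.toSyn (m + lm ord s)) :
    MvPowerSeries.coeff ν (q * s) = 0 := by
  classical
  rw [MvPowerSeries.coeff_mul]
  refine Finset.sum_eq_zero fun p hp => ?_
  rw [Finset.HasAntidiagonal.mem_antidiagonal] at hp
  rcases lt_or_ge (ord.toSyn p.1) (ord.toSyn m) with h | h
  · rw [hq _ h, zero_mul]
  · have : ord.toSyn p.2 < ord.toSyn (lm ord s) := by
      by_contra h'
      rw [← hp, map_add, map_add] at hν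
      exact (add_le_add h (le_of_not_gt h')).not_gt hν
    rw [coeff_eq_zero_of_lt_lm this, mul_zero]

theorem coeff_monomial_mul_eq_zero_of_lt {s : MvPowerSeries (Fin n) K} {m ν : Fin n →₀ ℕ}
    (hν : ord.toSyn ν < ord.toSyn (m + lm ord s)) :
    MvPowerSeries.coeff ν (MvPowerSeries.monomial m (1 : K) * s) = 0 := by
  classical
  refine coeff_mul_eq_zero_of_lt (fun μ hμ => ?_) hν
  rw [MvPowerSeries.coeff_monomial, if_neg]
  rintro rfl
  exact lt_irrefl _ hμ

theorem lm_mul {q s : MvPowerSeries (Fin n) K} (hq : q ≠ 0) (hs : s ≠ 0) :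
    lm ord (q * s) = lm ord q + lm ord s := by
  classical
  refine lm_eq_of ?_ fun ν hν => coeff_mul_eq_zero_of_lt (fun μ => coeff_eq_zero_of_lt_lm) hν
  -- A pair with non-zero contribution has both components at least the leading monomials; having
  -- the same sum, it equals the leading pair.
  rw [MvPowerSeries.coeff_mul, Finset.sum_eq_single (lm ord q, lm ord s)]
  · exact mul_ne_zero (lc_ne_zero hq) (lc_ne_zero hs)
  · intro p hp hne
    rw [Finset.HasAntidiagonal.mem_antidiagonal] at hp
    by_contra h
    have h1 := lm_le (ord := ord) (left_ne_zero_of_mul h)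
    have h2 := lm_le (ord := ord) (right_ne_zero_of_mul h)
    have hp' := congrArg ord.toSyn hp
    rw [map_add, map_add] at hp'
    have e1 : ord.toSyn (lm ord q) = ord.toSyn p.1 := by
      refine h1.eq_of_not_lt fun hlt => ?_
      exact (add_lt_add_of_lt_of_le hlt h2).ne hp'.symm
    rw [e1] at hp'
    have e2 : ord.toSyn (lm ord s) = ord.toSyn p.2 := (add_left_cancel hp').symm
    exact hne (Prod.ext (ord.toSyn.injective e1.symm) (ord.toSyn.injective e2.symm))
  · intro h
    rw [Finset.HasAntidiagonal.mem_antidiagonal] at h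
    exact absurd rfl h

/-! ### The rewriting relation -/

/-- A rewriting step cancels a whole term of `f` by a multiple of an element of `G`. -/
theorem rew_iff {f g : MvPowerSeries (Fin n) K} :
    Rew ord G f g ↔ ∃ (m : Fin n →₀ ℕ) (s : MvPowerSeries (Fin n) K), s ∈ G ∧ s ≠ 0 ∧
      MvPowerSeries.coeff (m + lm ord s) f ≠ 0 ∧
      g = f - (MvPowerSeries.coeff (m + lm ord s) f / lc ord s) •
        (MvPowerSeries.monomial m (1 : K) * s) := by
  classical
  have key : ∀ (c : K) (m : Fin n →₀ ℕ) (s S : MvPowerSeries (Fin n) K), s ≠ 0 →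
      (c / lc ord s) • (MvPowerSeries.monomial m (1 : K) * rem ord s) + S =
        MvPowerSeries.monomial (m + lm ord s) c + S -
          (c / lc ord s) • (MvPowerSeries.monomial m (1 : K) * s) := by
    intro c m s S hs
    rw [rem, mul_sub, MvPowerSeries.monomial_mul_monomial, one_mul, smul_sub, ← map_smul,
      smul_eq_mul, div_mul_cancel₀ _ (lc_ne_zero hs)]
    abel
  constructor
  · rintro ⟨c, m, s, S, hc, hsG, hs, hS, rfl, rfl⟩
    have hS' : MvPowerSeries.coeff (m + lm ord s) S = 0 := not_not.1 hS
    have hcoeff : MvPowerSeries.coeff (m + lm ord s)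
        (MvPowerSeries.monomial (m + lm ord s) c + S) = c := by
      rw [map_add, hS', add_zero, MvPowerSeries.coeff_monomial_same]
    exact ⟨m, s, hsG, hs, by rwa [hcoeff], by rw [hcoeff, key c m s S hs]⟩
  · rintro ⟨m, s, hsG, hs, hc, rfl⟩
    refine ⟨MvPowerSeries.coeff (m + lm ord s) f, m, s,
      f - MvPowerSeries.monomial (m + lm ord s) (MvPowerSeries.coeff (m + lm ord s) f),
      hc, hsG, hs, ?_, by abel, ?_⟩
    · simp [supp, MvPowerSeries.coeff_monomial_same]
    · rw [key _ m s _ hs, add_sub_cancel]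

theorem Rew.mono {G' : Set (MvPowerSeries (Fin n) K)} (h : G ⊆ G')
    {f g : MvPowerSeries (Fin n) K} (hfg : Rew ord G f g) : Rew ord G' f g := by
  obtain ⟨c, m, s, S, hc, hs, h'⟩ := hfg
  exact ⟨c, m, s, S, hc, h hs, h'⟩

theorem TopRew.mono {G' : Set (MvPowerSeries (Fin n) K)} (h : G ⊆ G')
    {f g : MvPowerSeries (Fin n) K} (hfg : TopRew (adicTopology n K) (Rew ord G) f g) :
    TopRew (adicTopology n K) (Rew ord G') f g := by
  rw [topRew_iff_agreeBelow] at hfg ⊢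
  intro N
  obtain ⟨b', hb', hr⟩ := hfg N
  exact ⟨b', hb', ReflTransGen.mono (fun _ _ => Rew.mono h) _ _ hr⟩

theorem sub_mem_span_of_reflTransGen {f g : MvPowerSeries (Fin n) K}
    (h : ReflTransGen (Rew ord G) f g) : f - g ∈ Ideal.span G := by
  induction h with
  | refl => simp
  | @tail b c _ hbc ih =>
    obtain ⟨m, s, hsG, hs, hc, rfl⟩ := rew_iff.1 hbc
    rw [← sub_add]
    refine add_mem ih ?_
    rw [MvPowerSeries.smul_eq_C_mul]
    exact Ideal.mul_mem_left _ _ (Ideal.mul_mem_left _ _ (Ideal.subset_span hsG))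

/-- Approximation by the ideal at each precision replaces any appeal to the ideal being closed. -/
theorem exists_mem_span_agreeBelow {a b : MvPowerSeries (Fin n) K}
    (h : TopRew (adicTopology n K) (Rew ord G) a b) (N : ℕ) :
    ∃ p ∈ Ideal.span G, AgreeBelow N p (a - b) := by
  obtain ⟨b', hb', hr⟩ := (topRew_iff_agreeBelow _ _ _).1 h N
  refine ⟨a - b', sub_mem_span_of_reflTransGen hr, fun μ hμ => ?_⟩
  rw [map_sub, map_sub, hb' μ hμ]

/-! ### Normal forms -/

/-- The multiples of the leading monomials of the non-zero elements of `G`. -/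
def Reducible (ord : MonomialOrder (Fin n)) (G : Set (MvPowerSeries (Fin n) K))
    (μ : Fin n →₀ ℕ) : Prop :=
  ∃ s ∈ G, s ≠ 0 ∧ lm ord s ≤ μ

/-- A term at a reducible monomial can be rewritten without changing smaller terms. -/
theorem Reducible.exists_rew {μ : Fin n →₀ ℕ} (hμ : Reducible ord G μ)
    {a : MvPowerSeries (Fin n) K} (ha : MvPowerSeries.coeff μ a ≠ 0) :
    ∃ a', Rew ord G a a' ∧ MvPowerSeries.coeff μ a' = 0 ∧
      ∀ ν, ord.toSyn ν < ord.toSyn μ → MvPowerSeries.coeff ν a' = MvPowerSeries.coeff ν a := by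
  obtain ⟨s, hsG, hs, hle⟩ := hμ
  obtain ⟨m, rfl⟩ : ∃ m, μ = m + lm ord s := ⟨μ - lm ord s, (tsub_add_cancel_of_le hle).symm⟩
  refine ⟨_, rew_iff.2 ⟨m, s, hsG, hs, ha, rfl⟩, ?_, fun ν hν => ?_⟩
  · rw [map_sub, MvPowerSeries.coeff_smul, coeff_add_lm_monomial_mul,
      div_mul_cancel₀ _ (lc_ne_zero hs), sub_self]
  · rw [map_sub, MvPowerSeries.coeff_smul, coeff_monomial_mul_eq_zero_of_lt hν, mul_zero, sub_zero]

theorem finite_degree_lt (N : ℕ) : {μ : Fin n →₀ ℕ | μ.degree < N}.Finite := by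
  refine (Set.finite_Iic (Finsupp.equivFunOnFinite.symm fun _ : Fin n => N)).subset ?_
  intro μ hμ i
  exact (Finsupp.le_degree i μ).trans (le_of_lt hμ)

/-- `a` has no reducible term of degree less than `N`. -/
def ReducedBelow (ord : MonomialOrder (Fin n)) (G : Set (MvPowerSeries (Fin n) K)) (N : ℕ)
    (a : MvPowerSeries (Fin n) K) : Prop :=
  ∀ μ : Fin n →₀ ℕ, μ.degree < N → Reducible ord G μ → MvPowerSeries.coeff μ a = 0

/-- Cancelling the smallest reducible term creates only larger ones, so finitely many steps clear
the degrees below `N`. These steps take place in degree at least `M`; the resulting agreement below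
`M` makes the successive stages of a normal form converge. -/
theorem exists_reducedBelow (hord : CompatibleWithDegree ord) (M N : ℕ)
    (a : MvPowerSeries (Fin n) K) (ha : ReducedBelow ord G M a) :
    ∃ a', ReflTransGen (Rew ord G) a a' ∧ AgreeBelow M a' a ∧ ReducedBelow ord G N a' := by
  classical
  -- the monomials of degree less than `N` above some reducible term of `a`
  let B : MvPowerSeries (Fin n) K → Set (Fin n →₀ ℕ) := fun a =>
    {ν | ν.degree < N ∧ ∃ μ, Reducible ord G μ ∧ MvPowerSeries.coeff μ a ≠ 0 ∧
      ord.toSyn μ ≤ ord.toSyn ν}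
  have hfin : ∀ a, (B a).Finite := fun a => (finite_degree_lt N).subset fun ν hν => hν.1
  induction hk : (B a).ncard using Nat.strong_induction_on generalizing a with
  | _ k ih =>
    by_cases hred : ReducedBelow ord G N a
    · exact ⟨a, .refl, fun _ _ => rfl, hred⟩
    let T : Set (Fin n →₀ ℕ) := {μ | Reducible ord G μ ∧ MvPowerSeries.coeff μ a ≠ 0}
    obtain ⟨ν, hνN, hνR, hνc⟩ : ∃ ν : Fin n →₀ ℕ, ν.degree < N ∧ Reducible ord G ν ∧
        MvPowerSeries.coeff ν a ≠ 0 := by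
      simpa [ReducedBelow] using hred
    have hT : T.Nonempty := ⟨ν, hνR, hνc⟩
    obtain ⟨μ, ⟨hμR, hμc⟩, hmin⟩ : ∃ μ ∈ T, ∀ ν ∈ T, ord.toSyn μ ≤ ord.toSyn ν :=
      ⟨_, Function.argminOn_mem ord.toSyn T hT, fun ν hν => Function.argminOn_le ord.toSyn T hν⟩
    have hμN : μ.degree < N := by
      by_contra h
      exact (hmin ν ⟨hνR, hνc⟩).not_gt (hord _ _ (hνN.trans_le (not_lt.1 h)))
    have hμM : M ≤ μ.degree := by
      by_contra h
      exact hμc (ha μ (not_le.1 h) hμR)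
    obtain ⟨a', hr, h0, hlow⟩ := hμR.exists_rew hμc
    have hagree : AgreeBelow M a' a := fun ν hν => hlow ν (hord _ _ (hν.trans_le hμM))
    have hgt : ∀ ν, Reducible ord G ν → MvPowerSeries.coeff ν a' ≠ 0 →
        ord.toSyn μ < ord.toSyn ν := by
      intro ν hR hc
      refine lt_of_not_ge fun hle => ?_
      rcases hle.lt_or_eq with hlt | heq
      · rw [hlow ν hlt] at hc
        exact (hmin ν ⟨hR, hc⟩).not_gt hlt
      · rw [ord.toSyn.injective heq] at hc
        exact hc h0
    -- All reducible terms of `a'` lie strictly above `μ`, so `B a'` is contained in `B a` and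
    -- misses `μ`.
    have hlt : (B a').ncard < k := by
      rw [← hk]
      refine Set.ncard_lt_ncard ((Set.ssubset_iff_of_subset ?_).2
        ⟨μ, ⟨hμN, μ, hμR, hμc, le_rfl⟩, ?_⟩) (hfin a)
      · rintro ν ⟨hν, ρ, hρR, hρc, hle⟩
        exact ⟨hν, μ, hμR, hμc, ((hgt ρ hρR hρc).le.trans hle)⟩
      · rintro ⟨-, ρ, hρR, hρc, hle⟩
        exact (hgt ρ hρR hρc).not_ge hle
    obtain ⟨a'', h1, h2, h3⟩ := ih _ hlt a'
      (fun ν hν hR => by rw [hagree ν hν, ha ν hν hR]) rfl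
    exact ⟨a'', .head hr h1, h2.trans hagree, h3⟩

/-- Every power series rewrites to one without reducible terms. -/
theorem exists_normalForm (hord : CompatibleWithDegree ord) (G : Set (MvPowerSeries (Fin n) K))
    (a : MvPowerSeries (Fin n) K) :
    ∃ d, TopRew (adicTopology n K) (Rew ord G) a d ∧
      ∀ μ, Reducible ord G μ → MvPowerSeries.coeff μ d = 0 := by
  choose! F hF1 hF2 hF3 using fun (N : ℕ) (x : MvPowerSeries (Fin n) K)
    (hx : ReducedBelow ord G N x) => exists_reducedBelow hord N (N + 1) x hx
  let u : ℕ → MvPowerSeries (Fin n) K := fun N => Nat.rec a F N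
  have hu : ∀ N, ReducedBelow ord G N (u N) := by
    intro N
    induction N with
    | zero => exact fun μ hμ => absurd hμ (Nat.not_lt_zero _)
    | succ N ih => exact hF3 N _ ih
  have hrew : ∀ N, ReflTransGen (Rew ord G) a (u N) := by
    intro N
    induction N with
    | zero => exact .refl
    | succ N ih => exact ih.trans (hF1 N _ (hu N))
  have hstable : ∀ M N, M ≤ N → AgreeBelow M (u N) (u M) := by
    intro M N hMN
    induction N, hMN using Nat.le_induction with
    | base => exact fun _ _ => rfl
    | succ N hMN ih =>
      exact fun μ hμ => (hF2 N _ (hu N) μ (hμ.trans_le hMN)).trans (ih μ hμ)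
  -- The coefficient at `μ` no longer changes from stage `μ.degree + 1` on, so this is the limit of
  -- `u`.
  let d : MvPowerSeries (Fin n) K := fun μ => MvPowerSeries.coeff μ (u (μ.degree + 1))
  have hd : ∀ μ, MvPowerSeries.coeff μ d = MvPowerSeries.coeff μ (u (μ.degree + 1)) :=
    fun _ => rfl
  refine ⟨d, (topRew_iff_agreeBelow _ _ _).2 fun N => ⟨u N, fun μ hμ => ?_, hrew N⟩,
    fun μ hμ => ?_⟩
  · rw [hd, hstable _ _ hμ μ (Nat.lt_succ_self _)]
  · rw [hd, hu _ μ (Nat.lt_succ_self _) hμ]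

/-- For a standard basis, two power series whose difference is adherent to the ideal rewrite to
the same normal form. -/
theorem IsStandardBasis.exists_common (hord : CompatibleWithDegree ord)
    (hG : IsStandardBasis ord G (Ideal.span G)) {b c : MvPowerSeries (Fin n) K}
    (hbc : ∀ N, ∃ p ∈ Ideal.span G, AgreeBelow N p (b - c)) :
    ∃ d, TopRew (adicTopology n K) (Rew ord G) b d ∧
      TopRew (adicTopology n K) (Rew ord G) c d := by
  obtain ⟨d, hbd, hd⟩ := exists_normalForm hord G b
  obtain ⟨e, hce, he⟩ := exists_normalForm hord G c
  suffices h : d = e by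
    subst h
    exact ⟨d, hbd, hce⟩
  by_contra hne
  have hne' : d - e ≠ 0 := sub_ne_zero.2 hne
  -- Precision one above the degree of the leading monomial of `d - e` covers that monomial and all
  -- smaller ones. The combination used is `(b - c) - (b - d) + (c - e) = d - e`.
  obtain ⟨p, hp, hpA⟩ := hbc ((lm ord (d - e)).degree + 1)
  obtain ⟨q, hq, hqA⟩ := exists_mem_span_agreeBelow hbd ((lm ord (d - e)).degree + 1)
  obtain ⟨r, hr, hrA⟩ := exists_mem_span_agreeBelow hce ((lm ord (d - e)).degree + 1)
  have hA : AgreeBelow ((lm ord (d - e)).degree + 1) (p - q + r) (d - e) := by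
    intro μ hμ
    rw [map_add, map_sub, hpA μ hμ, hqA μ hμ, hrA μ hμ]
    simp only [map_sub]
    ring
  have hlc := lc_ne_zero (ord := ord) hne'
  have hlm : lm ord (p - q + r) = lm ord (d - e) := by
    refine lm_eq_of ?_ fun ν hν => ?_
    · rw [hA _ (Nat.lt_succ_self _)]
      exact hlc
    · rw [hA ν, coeff_eq_zero_of_lt_lm hν]
      by_contra h
      exact (hord _ _ (Nat.lt_of_succ_le (not_lt.1 h))).not_gt hν
  obtain ⟨s, hsG, hs, hle⟩ := hG.2 (p - q + r) (add_mem (sub_mem hp hq) hr) (by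
    intro h0
    apply hlc
    rw [lc, ← hA _ (Nat.lt_succ_self _), h0, map_zero])
  rw [hlm] at hle
  apply hlc
  rw [lc, map_sub, hd _ ⟨s, hsG, hs, hle⟩, he _ ⟨s, hsG, hs, hle⟩, sub_zero]

theorem IsStandardBasis.infinitaryConfluent (hord : CompatibleWithDegree ord)
    (hG : IsStandardBasis ord G (Ideal.span G)) :
    InfinitaryConfluent (adicTopology n K) (Rew ord G) := by
  intro a b c hab hac
  refine hG.exists_common hord fun N => ?_
  obtain ⟨p, hp, hpA⟩ := exists_mem_span_agreeBelow hab N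
  obtain ⟨q, hq, hqA⟩ := exists_mem_span_agreeBelow hac N
  refine ⟨q - p, sub_mem hq hp, fun μ hμ => ?_⟩
  rw [map_sub, hpA μ hμ, hqA μ hμ]
  simp only [map_sub]
  ring

/-! ### Transitivity of infinitary rewriting -/

/-- Rewriting from `b` is shadowed from `b'`: a step in degree below `N` is copied, with the same
coefficient, and any other step is skipped since it changes nothing below `N`. -/
theorem AgreeBelow.exists_reflTransGen (hord : CompatibleWithDegree ord) {N : ℕ}
    {b b' c : MvPowerSeries (Fin n) K} (hb : AgreeBelow N b' b)
    (h : ReflTransGen (Rew ord G) b c) :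
    ∃ c', AgreeBelow N c' c ∧ ReflTransGen (Rew ord G) b' c' := by
  induction h with
  | refl => exact ⟨b', hb, .refl⟩
  | @tail x y _ hxy ih =>
    obtain ⟨x', hx', hr⟩ := ih
    obtain ⟨m, s, hsG, hs, hc, rfl⟩ := rew_iff.1 hxy
    by_cases hN : (m + lm ord s).degree < N
    · refine ⟨_, fun μ hμ => ?_, hr.tail (rew_iff.2 ⟨m, s, hsG, hs, by rwa [hx' _ hN], rfl⟩)⟩
      rw [map_sub, map_sub, hx' _ hN, hx' _ hμ]
    · refine ⟨x', fun μ hμ => ?_, hr⟩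
      rw [map_sub, MvPowerSeries.coeff_smul, coeff_monomial_mul_eq_zero_of_lt
        (hord _ _ (hμ.trans_le (not_lt.1 hN))), mul_zero, sub_zero, hx' μ hμ]

/-- The closure of a transitive relation need not be transitive; here shadowing transfers the
approximations of `c` from `b` to a nearby reduct of `a`. -/
theorem TopRew.trans (hord : CompatibleWithDegree ord) {a b c : MvPowerSeries (Fin n) K}
    (hab : TopRew (adicTopology n K) (Rew ord G) a b)
    (hbc : TopRew (adicTopology n K) (Rew ord G) b c) :
    TopRew (adicTopology n K) (Rew ord G) a c := by
  rw [topRew_iff_agreeBelow] at hab hbc ⊢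
  intro N
  obtain ⟨b', hb', hr⟩ := hab N
  obtain ⟨c', hc', hr'⟩ := hbc N
  obtain ⟨c'', hc'', hr''⟩ := hb'.exists_reflTransGen hord hr'
  exact ⟨c'', hc''.trans hc', hr.trans hr''⟩

/-! ### From confluence to standard bases -/

theorem isStandardBasis_singleton (s : MvPowerSeries (Fin n) K) :
    IsStandardBasis ord {s} (Ideal.span {s}) := by
  refine ⟨fun g hg => Ideal.subset_span hg, fun f hf hf0 => ?_⟩
  obtain ⟨q, rfl⟩ := Ideal.mem_span_singleton'.1 hf
  have hs : s ≠ 0 := right_ne_zero_of_mul hf0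
  refine ⟨s, rfl, hs, ?_⟩
  rw [lm_mul (left_ne_zero_of_mul hf0) hs]
  exact le_add_self

theorem exists_common_add_mul (hord : CompatibleWithDegree ord) {s : MvPowerSeries (Fin n) K}
    (hs : s ∈ G) (h q : MvPowerSeries (Fin n) K) :
    ∃ d, TopRew (adicTopology n K) (Rew ord G) (h + q * s) d ∧
      TopRew (adicTopology n K) (Rew ord G) h d := by
  obtain ⟨d, h1, h2⟩ := (isStandardBasis_singleton (ord := ord) s).exists_common hord
    (b := h + q * s) (c := h) fun N => ⟨q * s, Ideal.mem_span_singleton'.2 ⟨q, rfl⟩, by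
      rw [add_sub_cancel_left]
      exact fun _ _ => rfl⟩
  exact ⟨d, TopRew.mono (Set.singleton_subset_iff.2 hs) h1,
    TopRew.mono (Set.singleton_subset_iff.2 hs) h2⟩

/-- The arbitrary `h` lets a sum be added one summand at a time, and the arbitrary `q` absorbs
scalars. -/
theorem exists_common_add_of_mem_span (hord : CompatibleWithDegree ord)
    (hconf : InfinitaryConfluent (adicTopology n K) (Rew ord G)) {f : MvPowerSeries (Fin n) K}
    (hf : f ∈ Ideal.span G) (h q : MvPowerSeries (Fin n) K) :
    ∃ d, TopRew (adicTopology n K) (Rew ord G) (h + q * f) d ∧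
      TopRew (adicTopology n K) (Rew ord G) h d := by
  induction hf using Submodule.span_induction generalizing h q with
  | mem s hs => exact exists_common_add_mul hord hs h q
  | zero =>
    rw [mul_zero, add_zero]
    exact ⟨h, topRew_of_reflTransGen .refl, topRew_of_reflTransGen .refl⟩
  | add x y _ _ hx hy =>
    obtain ⟨d, hd1, hd2⟩ := hx h q
    obtain ⟨e, he1, he2⟩ := hy (h + q * x) q
    -- Confluence is applied at the intermediate series `h + q * x`, which rewrites to both `d` and
    -- `e`.
    obtain ⟨z, hdz, hez⟩ := hconf _ _ _ hd1 he2
    refine ⟨z, ?_, TopRew.trans hord hd2 hdz⟩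
    rw [mul_add, ← add_assoc]
    exact TopRew.trans hord he1 hez
  | smul r x _ hx =>
    rw [smul_eq_mul, ← mul_assoc]
    exact hx h (q * r)

theorem eq_zero_of_topRew_zero {d : MvPowerSeries (Fin n) K}
    (h : TopRew (adicTopology n K) (Rew ord G) 0 d) : d = 0 := by
  ext μ
  obtain ⟨b', hb', hr⟩ := (topRew_iff_agreeBelow _ _ _).1 h (μ.degree + 1)
  have h0 : b' = 0 := by
    clear hb'
    induction hr with
    | refl => rfl
    | tail _ hxy ih =>
      obtain ⟨m, s, -, -, hc, -⟩ := rew_iff.1 hxy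
      rw [ih, map_zero] at hc
      exact absurd rfl hc
  rw [← hb' μ (Nat.lt_succ_self _), h0]

/-- Rewriting never alters an irreducible leading term. -/
theorem coeff_eq_of_reflTransGen {f g : MvPowerSeries (Fin n) K} {μ : Fin n →₀ ℕ}
    (hμ : ¬ Reducible ord G μ) (hlow : ∀ ν, ord.toSyn ν < ord.toSyn μ →
      MvPowerSeries.coeff ν f = 0) (h : ReflTransGen (Rew ord G) f g) :
    (∀ ν, ord.toSyn ν < ord.toSyn μ → MvPowerSeries.coeff ν g = 0) ∧
      MvPowerSeries.coeff μ g = MvPowerSeries.coeff μ f := by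
  induction h with
  | refl => exact ⟨hlow, rfl⟩
  | @tail x y _ hxy ih =>
    obtain ⟨ih1, ih2⟩ := ih
    obtain ⟨m, s, hsG, hs, hc, rfl⟩ := rew_iff.1 hxy
    have hlt : ord.toSyn μ < ord.toSyn (m + lm ord s) := by
      refine lt_of_not_ge fun hle => ?_
      rcases hle.lt_or_eq with hlt | heq
      · exact hc (ih1 _ hlt)
      · exact hμ ⟨s, hsG, hs, by rw [← ord.toSyn.injective heq]; exact le_add_self⟩
    refine ⟨fun ν hν => ?_, ?_⟩
    · rw [map_sub, MvPowerSeries.coeff_smul, coeff_monomial_mul_eq_zero_of_lt (hν.trans hlt),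
        mul_zero, sub_zero, ih1 ν hν]
    · rw [map_sub, MvPowerSeries.coeff_smul, coeff_monomial_mul_eq_zero_of_lt hlt,
        mul_zero, sub_zero, ih2]

theorem isStandardBasis_of_infinitaryConfluent (hord : CompatibleWithDegree ord)
    (hconf : InfinitaryConfluent (adicTopology n K) (Rew ord G)) :
    IsStandardBasis ord G (Ideal.span G) := by
  refine ⟨fun g hg => Ideal.subset_span hg, fun f hf hf0 => ?_⟩
  by_contra hred
  obtain ⟨d, hd1, hd2⟩ := exists_common_add_of_mem_span hord hconf hf 0 1
  rw [zero_add, one_mul, eq_zero_of_topRew_zero hd2] at hd1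
  -- Since `f` rewrites to `0`, some finite reduct `b` vanishes up to and including the degree of
  -- `lm ord f`.
  obtain ⟨b, hb, hr⟩ := (topRew_iff_agreeBelow _ _ _).1 hd1 ((lm ord f).degree + 1)
  have h1 := (coeff_eq_of_reflTransGen hred (fun ν => coeff_eq_zero_of_lt_lm) hr).2
  rw [hb _ (Nat.lt_succ_self _), map_zero] at h1
  exact lc_ne_zero hf0 h1.symm

end FPS

theorem mainTheorem3 {K : Type*} [Field K] (n : ℕ) (ord : MonomialOrder (Fin n))
    (hord : FPS.CompatibleWithDegree ord) (G : Set (MvPowerSeries (Fin n) K)) :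
    FPS.IsStandardBasis ord G (Ideal.span G) ↔
      TopRewriting.InfinitaryConfluent (FPS.adicTopology n K) (FPS.Rew ord G) :=
  ⟨fun h => h.infinitaryConfluent hord, FPS.isStandardBasis_of_infinitaryConfluent hord⟩
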